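/- Let $K$ be a field, let $\mathbf S$ and $\mathbf H$ be finite-dimensional $K$-algebras, and let $e=e^2\in\mathbf S$ be an idempotent with $e\mathbf S e\cong\mathbf H$ as $K$-algebras. Modules are left modules, and $A$-mod denotes the category of finite-dimensional $A$-modules. Let $\mathcal F:\mathbf S\text{-mod}\to\mathbf H\text{-mod}$, $M\mapsto eM$, be the Schur functor and $\mathcal G:\mathbf H\text{-mod}\to\mathbf S\text{-mod}$, $N\mapsto\mathrm{Hom}_{\mathbf H}(e\mathbf S,N)$, the inverse Schur functor, with right derived functors $\mathcal R^i\mathcal G$. Suppose that $\mathbf H$ admits dual Specht modules, that is: (i) there is a family $\{S^\lambda\}_{\lambda\in\Lambda}$ of pairwise non-isomorphic finite-dimensional $\mathbf H$-modules indexed by a finite poset $\Lambda$ such that $\mathrm{Ext}^1_{\mathbf H}(S^\lambda,S^\mu)\neq0$ implies $\lambda>\mu$; (ii) there are a $K$-algebra automorphism $\#$ and a $K$-algebra anti-automorphism $*$ of $\mathbf H$ and an order-reversing involution $\lambda\mapsto\lambda^t$ of $\Lambda$ such that $S_{\lambda^t}\cong(S^\lambda)^\#$ for all $\lambda$. Here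 $M^\#$ is $M$ with $h$ acting as $h^\#$, $M^*=\mathrm{Hom}_K(M,K)$ with $(hf)(m)=f(h^*m)$, and $S_\lambda:=(S^\lambda)^*$. Suppose further that $\mathbf S$-mod is a highest weight category with standard modules $\Delta(\lambda):=\mathcal G(S_\lambda)$, $\lambda\in\Lambda$, that is: $\mathrm{End}_{\mathbf S}(\Delta(\lambda))=K$ for all $\lambda$; if $\mathrm{Hom}_{\mathbf S}(\Delta(\lambda),\Delta(\mu))\ne0$ then $\lambda\le\mu$; if $M\in\mathbf S$-mod and $\mathrm{Hom}_{\mathbf S}(\Delta(\lambda),M)=0$ for all $\lambda$, then $M=0$; and for each $\lambda$ there are a projective $P(\lambda)\in\mathbf S$-mod and a surjection $P(\lambda)\to\Delta(\lambda)$ whose kernel has a finite filtration with subquotients of the form $\Delta(\mu)$, $\mu>\lambda$. If $\mathcal R^1\mathcal G(S_\lambda)=0$ for all $\lambda\in\Lambda$, then $\mathcal F$ is a 1-faithful quasi-hereditary cover of $\mathbf H$. That is, $\mathcal F$ is an exact $K$-linear functor such that: (C1) there is a finite-dimensional projective $\mathbf S$-module $P$ with $\mathbf H\cong\mathrm{End}_{\mathbf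 S}(P)^{\mathrm{op}}$ (endomorphisms of the left module $P$ being written on the right) and $\mathcal F\cong\mathrm{Hom}_{\mathbf S}(P,-)$ compatibly with this isomorphism; (C2) $\mathcal F$ induces isomorphisms $\mathrm{Hom}_{\mathbf S}(M,N)\cong\mathrm{Hom}_{\mathbf H}(\mathcal F M,\mathcal F N)$ for all projective $M,N\in\mathbf S$-mod; (C3) $\mathcal F$ induces isomorphisms $\mathrm{Ext}^j_{\mathbf S}(M,N)\cong\mathrm{Ext}^j_{\mathbf H}(\mathcal F M,\mathcal F N)$, $j=0,1$, for all $M,N\in\mathbf S$-mod which have a finite filtration with subquotients of the form $\Delta(\lambda)$. -/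

import Mathlib

open CategoryTheory CategoryTheory.Limits
open scoped ModuleCat

universe u v

/-! ## Corner algebras -/

section Corner

variable {K S : Type u} [Field K] [Ring S] [Algebra K S] {e : S}

/-- The `K`-module structure on `eSe`, inherited from `S`. -/
instance cornerModule (he : IsIdempotentElem e) : Module K he.Corner where
  smul c x := ⟨c • x.1, by
    obtain ⟨h₁, h₂⟩ := (Subsemigroup.mem_corner_iff he).1 x.2
    exact (Subsemigroup.mem_corner_iff he).2
      ⟨by rw [mul_smul_comm, h₁], by rw [smul_mul_assoc, h₂]⟩⟩
  one_smul x := Subtype.ext (one_smul K x.1)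
  mul_smul a b x := Subtype.ext (mul_smul a b x.1)
  smul_zero a := Subtype.ext (smul_zero (A := S) a)
  smul_add a x y := Subtype.ext (smul_add a x.1 y.1)
  add_smul a b x := Subtype.ext (add_smul a b x.1)
  zero_smul x := Subtype.ext (zero_smul K x.1)

/-- The `K`-algebra structure on `eSe` (whose unit is `e`). -/
instance cornerAlgebra (he : IsIdempotentElem e) : Algebra K he.Corner :=
  Algebra.ofModule
    (fun r x y => Subtype.ext (smul_mul_assoc r x.1 y.1))
    (fun r x y => Subtype.ext (mul_smul_comm r x.1 y.1))

end Corner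

/-! ## The Schur functor `M ↦ eM` and the inverse Schur functor `N ↦ Hom_H(eS, N)` -/

section Schur

variable {K S H : Type u} [Field K] [Ring S] [Algebra K S] [Ring H] [Algebra K H]
  {e : S} {he : IsIdempotentElem e}

/-- The subgroup `eM` of an `S`-module `M`, as the set of elements fixed by the idempotent `e`. -/
def idemSubgroup (_he : IsIdempotentElem e) (M : Type u) [AddCommGroup M] [Module S M] :
    AddSubgroup M where
  carrier := {m | e • m = m}
  zero_mem' := smul_zero e
  add_mem' {a b} ha hb := by
    change e • (a + b) = a + b
    rw [smul_add, show e • a = a from ha, show e • b = b from hb]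
  neg_mem' {a} ha := by
    change e • (-a) = -a
    rw [smul_neg, show e • a = a from ha]

/-- `idemSubgroup` is indeed `{e m | m ∈ M}`. -/
theorem mem_idemSubgroup_iff_exists (M : Type u) [AddCommGroup M] [Module S M] (m : M) :
    m ∈ idemSubgroup he M ↔ ∃ x : M, e • x = m := by
  constructor
  · intro h
    exact ⟨m, h⟩
  · rintro ⟨x, rfl⟩
    change e • (e • x) = e • x
    rw [smul_smul, he.eq]

/-- The `H`-module `eM`, where `H` acts through an isomorphism `φ : H ≃ eSe`. -/
def IdemModule (_φ : H ≃ₐ[K] he.Corner) (M : Type u) [AddCommGroup M] [Module S M] : Type u :=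
  idemSubgroup he M

instance (φ : H ≃ₐ[K] he.Corner) (M : Type u) [AddCommGroup M] [Module S M] :
    AddCommGroup (IdemModule φ M) :=
  inferInstanceAs (AddCommGroup (idemSubgroup he M))

/-- `h` acts on `eM` as multiplication by the element `φ h` of `eSe`. -/
instance (φ : H ≃ₐ[K] he.Corner) (M : Type u) [AddCommGroup M] [Module S M] :
    Module H (IdemModule φ M) where
  smul h m := ⟨(φ h).1 • m.1, by
    change e • ((φ h).1 • m.1) = (φ h).1 • m.1
    rw [smul_smul, ((Subsemigroup.mem_corner_iff he).1 (φ h).2).1]⟩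
  one_smul m := Subtype.ext (by
    change (φ 1).1 • m.1 = m.1
    rw [map_one]
    exact m.2)
  mul_smul a b m := Subtype.ext (by
    change (φ (a * b)).1 • m.1 = (φ a).1 • ((φ b).1 • m.1)
    rw [map_mul, smul_smul]
    rfl)
  smul_zero a := Subtype.ext (smul_zero (φ a).1)
  smul_add a x y := Subtype.ext (smul_add (φ a).1 x.1 y.1)
  add_smul a b m := Subtype.ext (by
    change (φ (a + b)).1 • m.1 = (φ a).1 • m.1 + (φ b).1 • m.1
    rw [map_add, ← add_smul]
    rfl)
  zero_smul m := Subtype.ext (by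
    change (φ 0).1 • m.1 = 0
    rw [map_zero]
    exact zero_smul S m.1)

/-- The map `eM → eN` induced by an `S`-linear map `M → N`. -/
def IdemModule.map (φ : H ≃ₐ[K] he.Corner) {M N : Type u} [AddCommGroup M] [Module S M]
    [AddCommGroup N] [Module S N] (f : M →ₗ[S] N) : IdemModule φ M →ₗ[H] IdemModule φ N where
  toFun m := ⟨f m.1, by
    change e • f m.1 = f m.1
    rw [← map_smul]
    exact congrArg f m.2⟩
  map_add' x y := Subtype.ext (map_add f x.1 y.1)
  map_smul' h m := Subtype.ext (map_smul f (φ h).1 m.1)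

/-- The Schur functor `M ↦ eM`. -/
def schurFunctor (φ : H ≃ₐ[K] he.Corner) : ModuleCat.{u} S ⥤ ModuleCat.{u} H where
  obj M := ModuleCat.of H (IdemModule φ M)
  map f := ModuleCat.ofHom (IdemModule.map φ f.hom)

/-- Right multiplication by `s ∈ S` on the `(H, S)`-bimodule `eS`. -/
def idemRightMul (φ : H ≃ₐ[K] he.Corner) (s : S) : IdemModule φ S →ₗ[H] IdemModule φ S where
  toFun x := ⟨x.1 * s, by
    change e * (x.1 * s) = x.1 * s
    rw [← mul_assoc]
    exact congrArg (· * s) x.2⟩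
  map_add' x y := Subtype.ext (add_mul x.1 y.1 s)
  map_smul' h x := Subtype.ext (mul_assoc (φ h).1 x.1 s)

/-- The abelian group `Hom_H(eS, N)`. -/
def HomModule (φ : H ≃ₐ[K] he.Corner) (N : Type u) [AddCommGroup N] [Module H N] : Type u :=
  IdemModule φ S →ₗ[H] N

instance (φ : H ≃ₐ[K] he.Corner) (N : Type u) [AddCommGroup N] [Module H N] :
    AddCommGroup (HomModule φ N) :=
  inferInstanceAs (AddCommGroup (IdemModule φ S →ₗ[H] N))

/-- `Hom_H(eS, N)` is a left `S`-module through `(s f)(x) = f (x s)`. -/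
instance (φ : H ≃ₐ[K] he.Corner) (N : Type u) [AddCommGroup N] [Module H N] :
    Module S (HomModule φ N) where
  smul s f := LinearMap.comp f (idemRightMul φ s)
  one_smul f := LinearMap.ext fun x => congrArg (show IdemModule φ S →ₗ[H] N from f)
    (Subtype.ext (mul_one x.1))
  mul_smul a b f := LinearMap.ext fun x => congrArg (show IdemModule φ S →ₗ[H] N from f)
    (Subtype.ext (mul_assoc x.1 a b).symm)
  smul_zero a := LinearMap.zero_comp (idemRightMul φ a)
  smul_add a f g := LinearMap.add_comp (idemRightMul φ a) g f
  add_smul a b f := LinearMap.ext fun x =>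
    (congrArg (show IdemModule φ S →ₗ[H] N from f) (Subtype.ext (mul_add x.1 a b))).trans
      (map_add (show IdemModule φ S →ₗ[H] N from f) (idemRightMul φ a x) (idemRightMul φ b x))
  zero_smul f := LinearMap.ext fun x =>
    (congrArg (show IdemModule φ S →ₗ[H] N from f) (Subtype.ext (mul_zero x.1))).trans
      (map_zero (show IdemModule φ S →ₗ[H] N from f))

/-- Postcomposition `Hom_H(eS, M) → Hom_H(eS, N)`. -/
def HomModule.map (φ : H ≃ₐ[K] he.Corner) {M N : Type u} [AddCommGroup M] [Module H M]
    [AddCommGroup N] [Module H N] (g : M →ₗ[H] N) : HomModule φ M →ₗ[S] HomModule φ N where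
  toFun f := LinearMap.comp g f
  map_add' f f' := LinearMap.comp_add f f' g
  map_smul' s f := LinearMap.comp_assoc (idemRightMul φ s) f g |>.symm

/-- The inverse Schur functor `N ↦ Hom_H(eS, N)`. -/
def inverseSchurFunctor (φ : H ≃ₐ[K] he.Corner) : ModuleCat.{u} H ⥤ ModuleCat.{u} S where
  obj N := ModuleCat.of S (HomModule φ N)
  map g := ModuleCat.ofHom (HomModule.map φ g.hom)
  map_id _ := rfl
  map_comp _ _ := rfl

instance (φ : H ≃ₐ[K] he.Corner) : (inverseSchurFunctor φ).Additive where
  map_add := rfl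

end Schur

/-! ## Specht modules and dual Specht modules -/

section Specht

variable {K H : Type u} [Field K] [Ring H] [Algebra K H]

/-- The underlying space `Hom_K(M, K)` of the dual of `M` along an anti-automorphism. -/
def StarDual (_σ : H ≃ₐ[K] Hᵐᵒᵖ) (M : ModuleCat.{u} H) : Type u := M →ₗ[K] K

instance (σ : H ≃ₐ[K] Hᵐᵒᵖ) (M : ModuleCat.{u} H) : AddCommGroup (StarDual σ M) :=
  inferInstanceAs (AddCommGroup (M →ₗ[K] K))

/-- The action `(h f)(m) = f (h^* m)`. -/
instance (σ : H ≃ₐ[K] Hᵐᵒᵖ) (M : ModuleCat.{u} H) : Module H (StarDual σ M) where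
  smul h f := LinearMap.comp (show M →ₗ[K] K from f) (Algebra.lsmul K K M (σ h).unop)
  one_smul f := LinearMap.ext fun m => congrArg (show M →ₗ[K] K from f) (by
    change (σ 1).unop • m = m
    rw [map_one, MulOpposite.unop_one, one_smul])
  mul_smul a b f := LinearMap.ext fun m => congrArg (show M →ₗ[K] K from f) (by
    change (σ (a * b)).unop • m = (σ b).unop • ((σ a).unop • m)
    rw [map_mul, MulOpposite.unop_mul, mul_smul])
  smul_zero a := LinearMap.zero_comp _
  smul_add a f g := LinearMap.add_comp _ g f
  add_smul a b f := LinearMap.ext fun m =>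
    (congrArg (show M →ₗ[K] K from f) (by
      change (σ (a + b)).unop • m = (σ a).unop • m + (σ b).unop • m
      rw [map_add, MulOpposite.unop_add, add_smul])).trans (map_add (show M →ₗ[K] K from f) _ _)
  zero_smul f := LinearMap.ext fun m =>
    (congrArg (show M →ₗ[K] K from f) (by
      change (σ 0).unop • m = 0
      rw [map_zero, MulOpposite.unop_zero, zero_smul])).trans (map_zero (show M →ₗ[K] K from f))

/-- The dual `M^*` of an `H`-module along the anti-automorphism `σ`. -/
def starDual (σ : H ≃ₐ[K] Hᵐᵒᵖ) (M : ModuleCat.{u} H) : ModuleCat.{u} H :=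
  ModuleCat.of H (StarDual σ M)

/-- The twist `M^#`: the same space, on which `h` acts as `h^#`. -/
noncomputable def sharpTwist (τ : H ≃ₐ[K] H) (M : ModuleCat.{u} H) : ModuleCat.{u} H :=
  (ModuleCat.restrictScalars (τ : H →+* H)).obj M

variable (K H) in
/-- The data through which a finite-dimensional `K`-algebra `H` admits dual Specht modules
indexed by the poset `Λ`. (Over a finite-dimensional algebra, finitely generated modules are the
same as finite-dimensional ones.) -/
structure DualSpechtData (Λ : Type v) [PartialOrder Λ] where
  /-- the Specht modules `S^λ` -/
  specht : Λ → ModuleCat.{u} H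
  finite_specht : ∀ l, Module.Finite H (specht l)
  eq_of_iso : ∀ l m, Nonempty (specht l ≅ specht m) → l = m
  lt_of_ext : ∀ l m, Nontrivial (Abelian.Ext (specht l) (specht m) 1) → m < l
  /-- the automorphism `#` -/
  sharp : H ≃ₐ[K] H
  /-- the anti-automorphism `*` -/
  star : H ≃ₐ[K] Hᵐᵒᵖ
  /-- the order-reversing involution `λ ↦ λ^t` -/
  transpose : Λ → Λ
  transpose_transpose : ∀ l, transpose (transpose l) = l
  transpose_antitone : Antitone transpose
  sharp_iso : ∀ l, Nonempty (starDual star (specht (transpose l)) ≅ sharpTwist sharp (specht l))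

/-- The dual Specht module `S_λ = (S^λ)^*`. -/
def DualSpechtData.dualSpecht {Λ : Type v} [PartialOrder Λ] (D : DualSpechtData K H Λ) (l : Λ) :
    ModuleCat.{u} H :=
  starDual D.star (D.specht l)

end Specht

/-! ## Highest weight categories and 1-faithful covers -/

section HighestWeight

/-- `M` has a finite filtration `0 = F 0 ≤ F 1 ≤ ... ≤ F n = M` whose successive quotients are
isomorphic to modules `X l` with `l ∈ I`. -/
def HasFiltration {R : Type u} [Ring R] {Λ : Type v} (X : Λ → ModuleCat.{u} R) (I : Set Λ)
    (M : Type u) [AddCommGroup M] [Module R M] : Prop :=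
  ∃ (n : ℕ) (F : ℕ → Submodule R M), Monotone F ∧ F 0 = ⊥ ∧ F n = ⊤ ∧
    ∀ i < n, ∃ l ∈ I, Nonempty ((F (i + 1) ⧸ (F i).submoduleOf (F (i + 1))) ≃ₗ[R] X l)

variable (K : Type u) {S H : Type u} [Field K] [Ring S] [Algebra K S] [Ring H] [Algebra K H]
  {Λ : Type v} [PartialOrder Λ]

/-- The category of finite-dimensional modules over the finite-dimensional `K`-algebra `S` is a
highest weight category with standard modules `Δ l`. -/
structure IsHighestWeightCategory (Δ : Λ → ModuleCat.{u} S) : Prop where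
  finite_standard : ∀ l, Module.Finite S (Δ l)
  end_eq : ∀ l, Function.Bijective fun c : K => (c • 𝟙 (Δ l) : Δ l ⟶ Δ l)
  le_of_hom : ∀ l m, (∃ f : Δ l ⟶ Δ m, f ≠ 0) → l ≤ m
  eq_zero_of_hom : ∀ M : ModuleCat.{u} S, Module.Finite S M →
    (∀ (l : Λ) (f : Δ l ⟶ M), f = 0) → Subsingleton M
  exists_projective : ∀ l, ∃ (P : ModuleCat.{u} S) (p : P →ₗ[S] Δ l),
    Module.Finite S P ∧ Module.Projective S P ∧ Function.Surjective p ∧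
      HasFiltration Δ {m | l < m} (LinearMap.ker p)

/-- `F` is a 1-faithful quasi-hereditary cover of `H` by the highest weight category `S`-mod with
standard modules `Δ l`. -/
structure IsOneFaithfulCover (Δ : Λ → ModuleCat.{u} S) (F : ModuleCat.{u} S ⥤ ModuleCat.{u} H) :
    Prop where
  highestWeight : IsHighestWeightCategory K Δ
  /-- `F` is an exact `K`-linear functor which preserves finite-dimensional modules. -/
  [additive : F.Additive]
  [linear : F.Linear K]
  [preservesFiniteLimits : PreservesFiniteLimits F]
  [preservesFiniteColimits : PreservesFiniteColimits F]
  finite_obj : ∀ M : ModuleCat.{u} S, Module.Finite S M → Module.Finite H (F.obj M)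
  /-- `H` is the endomorphism algebra of a projective `S`-module `P` representing `F`. As `P` is a
  left module, its endomorphisms are written on the right, whence the opposite algebra. -/
  exists_projective : ∃ P : ModuleCat.{u} S, Module.Finite S P ∧ Module.Projective S P ∧
    ∃ (ψ : H ≃ₐ[K] (Module.End S P)ᵐᵒᵖ)
      (ε : ∀ M : ModuleCat.{u} S, (P →ₗ[S] M) ≃+ F.obj M),
      (∀ (M : ModuleCat.{u} S) (h : H) (f : P →ₗ[S] M),
        ε M (f ∘ₗ (ψ h).unop) = h • ε M f) ∧
      (∀ (M N : ModuleCat.{u} S) (g : M ⟶ N) (f : P →ₗ[S] M),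
        ε N (g.hom ∘ₗ f) = F.map g (ε M f))
  /-- `F` is fully faithful on finite-dimensional projective modules. -/
  hom_bijective : ∀ M N : ModuleCat.{u} S, Module.Finite S M → Module.Finite S N →
    Module.Projective S M → Module.Projective S N →
    Function.Bijective (F.map : (M ⟶ N) → (F.obj M ⟶ F.obj N))
  /-- `F` induces isomorphisms on `Ext^0 = Hom` and on `Ext^1` between modules with a
  `Δ`-filtration. -/
  ext_bijective : ∀ M N : ModuleCat.{u} S, HasFiltration Δ Set.univ M →
    HasFiltration Δ Set.univ N → ∀ j ≤ 1, Function.Bijective (F.mapExtAddHom M N j)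

end HighestWeight

/-! The Schur functor F is exact and left adjoint to G, and the counit FG → id is invertible because
eSe ≅ H (`schurCounit_bijective`). By a triangle identity the unit is then invertible on the image
of G, in particular on every Δ(λ). Wherever the unit at N is invertible, adjunction makes F
bijective on Hom(M, N) for arbitrary M.

For Ext¹, embed FN in an injective I with cokernel Q. If Ext¹_H(eS, FN) = 0, then G keeps 0 → FN → I
→ Q → 0 exact. Since N ≅ GFN and GI is injective, Ext¹(M, N) is the cokernel of Hom(M, GI) → Hom(M,
GQ), which adjunction identifies with the cokernel of Hom(FM, I) → Hom(FM, Q), that is, with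
Ext¹(FM, FN) (`mapExtAddHom_one_bijective`).

Both conditions on N form `IsSchurAcyclic`. They pass to extensions and hold for Δ(λ), because R¹G =
Ext¹_H(eS, -) and FG(S_λ) ≅ S_λ; hence they hold for all Δ-filtered modules. A finitely generated
projective is a retract of a module built by extensions from the P(λ), so its unit is invertible too
(`schurUnit_bijective_of_projective`). The projective representing F is Se. -/

/-! ### Hom and Ext¹ under an exact left adjoint -/

section ExtComparison

open Abelian

universe v₁ v₂ u₁ u₂ w₁ w₂

/-- If the unit at `N` is an isomorphism, then `F` is bijective on morphisms into `N`. -/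
theorem map_bijective_of_isIso_unit {C : Type u₁} [Category.{v₁} C] {D : Type u₂}
    [Category.{v₂} D] {F : C ⥤ D} {G : D ⥤ C} (adj : F ⊣ G) (M N : C)
    [IsIso (adj.unit.app N)] :
    Function.Bijective (F.map : (M ⟶ N) → (F.obj M ⟶ F.obj N)) := by
  have h : adj.homEquiv M (F.obj N) ∘ (F.map : (M ⟶ N) → (F.obj M ⟶ F.obj N)) =
      fun f => f ≫ adj.unit.app N := by
    funext f
    simp [Adjunction.homEquiv_unit]
  rw [← (adj.homEquiv M (F.obj N)).comp_bijective, h]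
  exact ⟨fun f g hfg => (cancel_mono _).1 hfg,
    fun g => ⟨g ≫ inv (adj.unit.app N), by simp⟩⟩

variable {C : Type u₁} [Category.{v₁} C] [Abelian C] {D : Type u₂} [Category.{v₂} D] [Abelian D]
  {F : C ⥤ D} {G : D ⥤ C}
  [F.Additive] [PreservesFiniteLimits F] [PreservesFiniteColimits F]
  [HasExt.{w₁} C] [HasExt.{w₂} D]

/-- Dimension shifting for the map induced by an exact functor on `Ext¹`. -/
theorem mapExtAddHom_one_bijective_of_comp_surjective {M N P : C} {Q : D} (δ : Ext P N 1)
    (δ' : Ext Q (F.obj N) 1) (t : F.obj P ⟶ Q)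
    (hδ : δ.mapExactFunctor F = (Ext.mk₀ t).comp δ' (zero_add 1))
    (h₁ : ∀ x : Ext M N 1, ∃ f : M ⟶ P, (Ext.mk₀ f).comp δ (zero_add 1) = x)
    (h₂ : ∀ y : Ext (F.obj M) (F.obj N) 1, ∃ g : F.obj M ⟶ Q,
      (Ext.mk₀ g).comp δ' (zero_add 1) = y)
    (ht : ∀ g : F.obj M ⟶ Q, ∃ f : M ⟶ P, F.map f ≫ t = g)
    (hz : ∀ f : M ⟶ P, (Ext.mk₀ (F.map f ≫ t)).comp δ' (zero_add 1) = 0 →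
      (Ext.mk₀ f).comp δ (zero_add 1) = 0) :
    Function.Bijective (F.mapExtAddHom M N 1) := by
  -- Both Ext¹ groups are covered by Hom groups via δ and δ'; on these covers F acts as f ↦ F f ≫ t.
  have key (f : M ⟶ P) : F.mapExtAddHom M N 1 ((Ext.mk₀ f).comp δ (zero_add 1)) =
      (Ext.mk₀ (F.map f ≫ t)).comp δ' (zero_add 1) := by
    rw [Functor.mapExtAddHom_apply, Ext.mapExactFunctor_comp, Ext.mapExactFunctor_mk₀, hδ,
      Ext.mk₀_comp_mk₀_assoc]
  refine ⟨(injective_iff_map_eq_zero _).2 fun x hx => ?_, fun y => ?_⟩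
  · obtain ⟨f, rfl⟩ := h₁ x
    exact hz f ((key f).symm.trans hx)
  · obtain ⟨g, rfl⟩ := h₂ y
    obtain ⟨f, rfl⟩ := ht g
    exact ⟨_, key f⟩

/-- The comparison map on `Ext¹` is bijective when the unit at `N` is an isomorphism and `G` keeps
exact an embedding of `F N` into an injective object. -/
theorem mapExtAddHom_one_bijective (adj : F ⊣ G) {N : C} (hN : IsIso (adj.unit.app N)) {I Q : D}
    (hI : Injective I) {i : F.obj N ⟶ I} {p : I ⟶ Q} {w : i ≫ p = 0}
    (hS : (ShortComplex.mk i p w).ShortExact) (hp : Epi (G.map p)) (M : C) :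
    Function.Bijective (F.mapExtAddHom M N 1) := by
  have := adj.right_adjoint_additive
  have := adj.rightAdjoint_preservesLimits
  have : PreservesFiniteLimits G := inferInstance
  obtain ⟨η, hη⟩ : ∃ η : N ⟶ G.obj (F.obj N), adj.unit.app N = η := ⟨_, rfl⟩
  have hη' : IsIso η := hη ▸ hN
  -- Of the counit, only naturality, the triangle identity at N and the universal property for maps
  -- out of F M are kept.
  obtain ⟨ε, hε, hεη, hεb, hεn⟩ : ∃ ε : ∀ X : D, F.obj (G.obj X) ⟶ X,
      (∀ {X Y : D} (f : X ⟶ Y), F.map (G.map f) ≫ ε Y = ε X ≫ f) ∧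
      F.map η ≫ ε (F.obj N) = 𝟙 _ ∧
      (∀ (X : D) (g : F.obj M ⟶ X), ∃ f : M ⟶ G.obj X, F.map f ≫ ε X = g) ∧
      (∀ (X : D) (f f' : M ⟶ G.obj X), F.map f ≫ ε X = F.map f' ≫ ε X → f = f') := by
    refine ⟨fun X => adj.counit.app X, fun f => adj.counit_naturality f,
      hη ▸ adj.left_triangle_components N, fun X g => ⟨adj.homEquiv _ _ g, ?_⟩,
      fun X f f' h => (adj.homEquiv _ _).symm.injective ?_⟩
    · rw [← adj.homEquiv_counit, Equiv.symm_apply_apply]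
    · rwa [adj.homEquiv_counit, adj.homEquiv_counit]
  have hw : (η ≫ G.map i) ≫ G.map p = 0 := by
    rw [Category.assoc, ← G.map_comp, w, Functor.map_zero, comp_zero]
  -- G is left exact as a right adjoint, `hp` supplies exactness on the right, and the unit replaces
  -- GFN by N.
  have hT : (ShortComplex.mk (η ≫ G.map i) (G.map p) hw).ShortExact := by
    have hG := G.preservesFiniteLimits_iff_forall_exact_map_and_mono.1 inferInstance _ hS
    let S' : ShortComplex C := ShortComplex.mk (G.map i) (G.map p)
      (by rw [← G.map_comp, w, Functor.map_zero])
    have hS' : S'.ShortExact := { exact := hG.1, mono_f := hG.2, epi_g := hp }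
    let S : ShortComplex C := ShortComplex.mk (η ≫ G.map i) (G.map p) hw
    let iso : S' ≅ S := ShortComplex.isoMk (asIso η).symm (Iso.refl _) (Iso.refl _)
      (show inv η ≫ η ≫ G.map i = G.map i ≫ 𝟙 _ by simp)
      (show 𝟙 _ ≫ G.map p = G.map p ≫ 𝟙 _ by simp)
    exact ShortComplex.shortExact_of_iso iso hS'
  have hGI : Injective (G.obj I) := Injective.injective_of_adjoint adj I
  refine mapExtAddHom_one_bijective_of_comp_surjective (P := G.obj Q) (Q := Q) hT.extClass
    hS.extClass (ε Q) ?_ ?_ ?_ (hεb Q) ?_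
  -- The counits give a morphism from the image under F of the new sequence to the original one,
  -- equal to the identity on F N; naturality of extension classes compares δ with δ'.
  · have hn := ShortComplex.ShortExact.extClass_naturality (hT.map_of_exact F) hS
      { τ₁ := 𝟙 (F.obj N)
        τ₂ := ε I
        τ₃ := ε Q
        comm₁₂ := by
          change 𝟙 (F.obj N) ≫ i = F.map (η ≫ G.map i) ≫ ε I
          rw [Category.id_comp, F.map_comp, Category.assoc, hε, ← Category.assoc, hεη,
            Category.id_comp]
        comm₂₃ := (hε p).symm }
    rw [Ext.mapExactFunctor_extClass]
    exact (Ext.comp_mk₀_id _).symm.trans hn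
  · intro x
    obtain ⟨f, hf⟩ := Ext.covariant_sequence_exact₁ M hT x
      (Ext.eq_zero_of_injective (I := G.obj I) _) (zero_add 1)
    obtain ⟨f, rfl⟩ := (Ext.mk₀_bijective _ _).2 f
    exact ⟨f, hf⟩
  · intro y
    obtain ⟨f, hf⟩ := Ext.covariant_sequence_exact₁ (F.obj M) hS y
      (Ext.eq_zero_of_injective (I := I) _) (zero_add 1)
    obtain ⟨f, rfl⟩ := (Ext.mk₀_bijective _ _).2 f
    exact ⟨f, hf⟩
  -- Vanishing of the class lifts F f ≫ ε Q through I. The adjoint of this lift factors f through G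
  -- p, which kills its class.
  · intro f hf
    obtain ⟨h, hh⟩ := Ext.covariant_sequence_exact₃ _ hS _ (zero_add 1) hf
    obtain ⟨h, rfl⟩ := (Ext.mk₀_bijective _ _).2 h
    obtain ⟨k, rfl⟩ := hεb I h
    have hh' : Ext.mk₀ ((F.map k ≫ ε I) ≫ p) = Ext.mk₀ (F.map f ≫ ε Q) :=
      (Ext.mk₀_comp_mk₀ _ _).symm.trans hh
    have hk : f = k ≫ G.map p := hεn Q _ _ (by
      rw [← (Ext.mk₀_bijective _ _).1 hh', F.map_comp, Category.assoc, Category.assoc, hε])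
    subst hk
    rw [← Ext.mk₀_comp_mk₀_assoc]
    exact (congrArg (fun z => (Ext.mk₀ k).comp z (zero_add 1)) hT.comp_extClass).trans
      (Ext.comp_zero _ _ _ _ _)

end ExtComparison

/-! ### The adjunction between the Schur functor and its inverse -/

section SchurAdjunction

variable {K S H : Type u} [Field K] [Ring S] [Algebra K S] [Ring H] [Algebra K H]
  {e : S} {he : IsIdempotentElem e} (φ : H ≃ₐ[K] he.Corner)

theorem coe_map_mul_idem (h : H) : (φ h).1 * e = (φ h).1 :=
  ((Subsemigroup.mem_corner_iff he).1 (φ h).2).2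

theorem idem_mul_coe_map (h : H) : e * (φ h).1 = (φ h).1 :=
  ((Subsemigroup.mem_corner_iff he).1 (φ h).2).1

theorem coe_map_algebraMap (c : K) : (φ (algebraMap K H c)).1 = c • e := by
  rw [AlgEquiv.commutes, Algebra.algebraMap_eq_smul_one]
  rfl

instance : (schurFunctor φ).Additive where
  map_add := rfl

instance : (schurFunctor φ).Linear K where
  map_smul {M N} f c := by
    refine ModuleCat.hom_ext (LinearMap.ext fun m => Subtype.ext ?_)
    -- On the target, c acts through H as c • e, which agrees with c because e fixes eN.
    change algebraMap K S c • f.hom m.1 = (φ (algebraMap K H c)).1 • f.hom m.1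
    have hm : e • f.hom m.1 = f.hom m.1 := (IdemModule.map φ f.hom m).2
    rw [coe_map_algebraMap, ← smul_one_mul c e, ← Algebra.algebraMap_eq_smul_one]
    exact ((mul_smul _ _ _).trans (congrArg (algebraMap K S c • ·) hm)).symm

/-- The generator `e` of `eS`. -/
def idemGenerator : IdemModule φ S := ⟨e, he.eq⟩

/-- The element of `H` corresponding to `x e ∈ eSe`. -/
def idemCoeff (x : IdemModule φ S) : H :=
  φ.symm ⟨x.1 * e, (Subsemigroup.mem_corner_iff he).2
    ⟨by rw [← mul_assoc]; exact congrArg (· * e) x.2, by rw [mul_assoc, he.eq]⟩⟩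

theorem coe_map_idemCoeff (x : IdemModule φ S) : (φ (idemCoeff φ x)).1 = x.1 * e :=
  congrArg Subtype.val (φ.apply_symm_apply _)

theorem idemCoeff_smul_generator (x : IdemModule φ S) :
    idemCoeff φ x • idemGenerator φ = idemRightMul φ e x :=
  Subtype.ext (by
    change (φ (idemCoeff φ x)).1 * e = x.1 * e
    rw [coe_map_mul_idem, coe_map_idemCoeff])

theorem idemCoeff_eq_of_coe {x : IdemModule φ S} {h : H} (hx : (φ h).1 = x.1 * e) :
    idemCoeff φ x = h :=
  φ.injective (Subtype.ext ((coe_map_idemCoeff φ x).trans hx.symm))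

/-- The coefficient map `x ↦ x e`, from `eS` to `H ≅ eSe`. -/
def idemCoeffHom : IdemModule φ S →ₗ[H] H where
  toFun := idemCoeff φ
  map_add' x y := idemCoeff_eq_of_coe φ (by
    rw [map_add]
    change (φ (idemCoeff φ x)).1 + (φ (idemCoeff φ y)).1 = (x.1 + y.1) * e
    rw [coe_map_idemCoeff, coe_map_idemCoeff, add_mul])
  map_smul' h x := idemCoeff_eq_of_coe φ (by
    rw [RingHom.id_apply, smul_eq_mul, map_mul]
    change (φ h).1 * (φ (idemCoeff φ x)).1 = ((φ h).1 * x.1) * e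
    rw [coe_map_idemCoeff, mul_assoc])

section Unit

variable (M : Type u) [AddCommGroup M] [Module S M]

/-- The unit `M → Hom_H(eS, eM)`, sending `m` to `x ↦ x m`. -/
def schurUnit : M →ₗ[S] HomModule φ (IdemModule φ M) where
  toFun m := show IdemModule φ S →ₗ[H] IdemModule φ M from
    { toFun := fun x => ⟨x.1 • m, by
        change e • (x.1 • m) = x.1 • m
        rw [smul_smul]
        exact congrArg (· • m) x.2⟩
      map_add' := fun x y => Subtype.ext (add_smul x.1 y.1 m)
      map_smul' := fun h x => Subtype.ext (mul_smul (φ h).1 x.1 m) }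
  map_add' m n := LinearMap.ext fun x => Subtype.ext (smul_add x.1 m n)
  map_smul' s m := LinearMap.ext fun x => Subtype.ext (smul_smul x.1 s m)

end Unit

section Counit

variable (N : Type u) [AddCommGroup N] [Module H N]

/-- The counit `e Hom_H(eS, N) → N`, sending `f` to `f e`. -/
def schurCounit : IdemModule φ (HomModule φ N) →ₗ[H] N where
  toFun f := (show IdemModule φ S →ₗ[H] N from f.1) (idemGenerator φ)
  map_add' _ _ := rfl
  map_smul' h f := by
    let g : IdemModule φ S →ₗ[H] N := f.1
    change g (idemRightMul φ (φ h).1 (idemGenerator φ)) = h • g (idemGenerator φ)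
    rw [← map_smul]
    refine congrArg g (Subtype.ext ?_)
    change e * (φ h).1 = (φ h).1 * e
    rw [coe_map_mul_idem, idem_mul_coe_map]

/-- If e fixes f, then f(x) = f(xe), and xe ∈ eSe is the action of an element of H on e; so f(e)
determines f. Conversely, n is the value at e of x ↦ (xe)n. -/
theorem schurCounit_bijective : Function.Bijective (schurCounit φ N) := by
  refine ⟨(injective_iff_map_eq_zero _).2 fun f hf => Subtype.ext (LinearMap.ext fun x => ?_),
    fun n => ?_⟩
  · let g : IdemModule φ S →ₗ[H] N := f.1
    have hg : g (idemGenerator φ) = 0 := hf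
    have hx : g (idemRightMul φ e x) = g x := LinearMap.congr_fun (show
      (g ∘ₗ idemRightMul φ e) = g from f.2) x
    change g x = 0
    rw [← hx, ← idemCoeff_smul_generator, map_smul, hg, smul_zero]
  · refine ⟨⟨(idemCoeffHom φ).smulRight n, LinearMap.ext fun x => ?_⟩, ?_⟩
    · change idemCoeff φ (idemRightMul φ e x) • n = idemCoeff φ x • n
      congr 1
      refine idemCoeff_eq_of_coe φ ?_
      change (φ (idemCoeff φ x)).1 = (x.1 * e) * e
      rw [coe_map_idemCoeff, mul_assoc, he.eq]
    · change idemCoeff φ (idemGenerator φ) • n = n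
      rw [idemCoeff_eq_of_coe φ (h := 1), one_smul]
      rw [map_one]
      exact he.eq.symm

end Counit

/-- The Schur functor is left adjoint to the inverse Schur functor. -/
def schurAdjunction : schurFunctor φ ⊣ inverseSchurFunctor φ :=
  Adjunction.mkOfUnitCounit
    { unit :=
        { app := fun M => ModuleCat.ofHom (schurUnit φ M)
          naturality := fun M N f => ModuleCat.hom_ext (LinearMap.ext fun m =>
            LinearMap.ext fun x => Subtype.ext (map_smul f.hom x.1 m).symm) }
      counit :=
        { app := fun N => ModuleCat.ofHom (schurCounit φ N)
          naturality := fun _ _ _ => rfl }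
      left_triangle := by
        refine NatTrans.ext (funext fun M => ModuleCat.hom_ext (LinearMap.ext fun m => ?_))
        exact Subtype.ext m.2
      right_triangle := by
        refine NatTrans.ext (funext fun N => ModuleCat.hom_ext (LinearMap.ext fun f => ?_))
        exact LinearMap.ext fun x =>
          congrArg (show IdemModule φ S →ₗ[H] N from f) (Subtype.ext x.2) }

instance (N : ModuleCat.{u} H) : IsIso ((schurAdjunction φ).counit.app N) :=
  (ConcreteCategory.isIso_iff_bijective _).2 (schurCounit_bijective φ N)

theorem isIso_schurAdjunction_unit_iff (M : ModuleCat.{u} S) :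
    IsIso ((schurAdjunction φ).unit.app M) ↔ Function.Bijective (schurUnit φ M) :=
  ConcreteCategory.isIso_iff_bijective _

/-- The unit at G N is a one-sided inverse of G applied to the counit, which is invertible. -/
theorem schurUnit_bijective_inverseSchurFunctor (N : ModuleCat.{u} H) :
    Function.Bijective (schurUnit φ ((inverseSchurFunctor φ).obj N)) := by
  rw [← isIso_schurAdjunction_unit_iff]
  have h := (schurAdjunction φ).right_triangle_components N
  have : IsIso ((schurAdjunction φ).unit.app ((inverseSchurFunctor φ).obj N) ≫
      (inverseSchurFunctor φ).map ((schurAdjunction φ).counit.app N)) := by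
    rw [h]
    infer_instance
  exact IsIso.of_isIso_comp_right _ ((inverseSchurFunctor φ).map ((schurAdjunction φ).counit.app N))

end SchurAdjunction

/-! ### Exactness of the Schur functor; closure properties of bijective units -/

section SchurExact

variable {K S H : Type u} [Field K] [Ring S] [Algebra K S] [Ring H] [Algebra K H]
  {e : S} {he : IsIdempotentElem e} (φ : H ≃ₐ[K] he.Corner)

variable {A B C : Type u} [AddCommGroup A] [Module S A] [AddCommGroup B] [Module S B]
  [AddCommGroup C] [Module S C]

theorem IdemModule.map_injective {f : A →ₗ[S] B} (hf : Function.Injective f) :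
    Function.Injective (IdemModule.map φ f) := fun _ _ h =>
  Subtype.ext (hf (congrArg Subtype.val h))

theorem IdemModule.map_surjective {f : A →ₗ[S] B} (hf : Function.Surjective f) :
    Function.Surjective (IdemModule.map φ f) := fun b => by
  obtain ⟨a, ha⟩ := hf b.1
  refine ⟨⟨e • a, ?_⟩, Subtype.ext ?_⟩
  · change e • e • a = e • a
    rw [smul_smul, he.eq]
  · change f (e • a) = b.1
    rw [map_smul, ha]
    exact b.2

theorem IdemModule.map_exact {f : A →ₗ[S] B} {g : B →ₗ[S] C} (h : Function.Exact f g) :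
    Function.Exact (IdemModule.map φ f) (IdemModule.map φ g) := by
  intro b
  constructor
  · intro hb
    obtain ⟨a, ha⟩ := (h b.1).1 (congrArg Subtype.val hb)
    refine ⟨⟨e • a, ?_⟩, Subtype.ext ?_⟩
    · change e • e • a = e • a
      rw [smul_smul, he.eq]
    · change f (e • a) = b.1
      rw [map_smul, ha]
      exact b.2
  · rintro ⟨a, rfl⟩
    exact Subtype.ext ((h (f a.1)).2 ⟨a.1, rfl⟩)

theorem schurFunctor_exact :
    PreservesFiniteLimits (schurFunctor φ) ∧ PreservesFiniteColimits (schurFunctor φ) := by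
  -- Items 1 and 3 are preservation of exact sequences and preservation of finite limits and
  -- colimits.
  refine ((schurFunctor φ).exact_tfae.out 1 3).1 fun T hT => ?_
  rw [ShortComplex.ShortExact.moduleCat_exact_iff_function_exact] at hT ⊢
  exact IdemModule.map_exact φ hT

instance : PreservesFiniteLimits (schurFunctor φ) := (schurFunctor_exact φ).1

instance : PreservesFiniteColimits (schurFunctor φ) := (schurFunctor_exact φ).2

/-- The class of modules with bijective unit is closed under extensions. -/
theorem schurUnit_bijective_of_exact {f : A →ₗ[S] B} {g : B →ₗ[S] C}
    (hf : Function.Injective f) (hfg : Function.Exact f g) (hg : Function.Surjective g)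
    (hA : Function.Bijective (schurUnit φ A)) (hC : Function.Bijective (schurUnit φ C)) :
    Function.Bijective (schurUnit φ B) := by
  have hnat {X Y : Type u} [AddCommGroup X] [Module S X] [AddCommGroup Y] [Module S Y]
      (k : X →ₗ[S] Y) (x : X) :
      HomModule.map φ (IdemModule.map φ k) (schurUnit φ X x) = schurUnit φ Y (k x) :=
    LinearMap.ext fun z => Subtype.ext (map_smul k z.1 x)
  have hinj {X Y : Type u} [AddCommGroup X] [Module H X] [AddCommGroup Y] [Module H Y]
      {k : X →ₗ[H] Y} (hk : Function.Injective k) : Function.Injective (HomModule.map φ k) :=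
    fun a b hab => LinearMap.ext fun z => hk (LinearMap.congr_fun hab z)
  constructor
  · rw [injective_iff_map_eq_zero]
    intro b hb
    have h1 : g b = 0 := (injective_iff_map_eq_zero _).1 hC.1 _ (by
      rw [← hnat, hb, map_zero])
    obtain ⟨a, rfl⟩ := (hfg b).1 h1
    have h2 : a = 0 := (injective_iff_map_eq_zero _).1 hA.1 _
      (hinj (IdemModule.map_injective φ hf) (by rw [hnat, hb, map_zero]))
    rw [h2, map_zero]
  · intro y
    obtain ⟨c, hc⟩ := hC.2 (HomModule.map φ (IdemModule.map φ g) y)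
    obtain ⟨b, rfl⟩ := hg c
    rw [← hnat] at hc
    -- The error z dies in Hom(eS, eC), and eA is the kernel of eB → eC, so z comes from a map eS →
    -- eA, where the unit of A is surjective.
    let z : IdemModule φ S →ₗ[H] IdemModule φ B := y - schurUnit φ B b
    have hz : (IdemModule.map φ g).comp z = 0 := by
      change HomModule.map φ (IdemModule.map φ g) (y - schurUnit φ B b) = 0
      rw [map_sub, hc, sub_self]
    have hex := IdemModule.map_exact φ hfg
    obtain ⟨w, hw⟩ : ∃ w : IdemModule φ S →ₗ[H] IdemModule φ A,
        (IdemModule.map φ f).comp w = z := by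
      have hr (x) : z x ∈ LinearMap.range (IdemModule.map φ f) :=
        (hex (z x)).1 (LinearMap.congr_fun hz x)
      let E := LinearEquiv.ofInjective (IdemModule.map φ f) (IdemModule.map_injective φ hf)
      refine ⟨E.symm.toLinearMap ∘ₗ z.codRestrict _ hr, LinearMap.ext fun x => ?_⟩
      exact congrArg Subtype.val (E.apply_symm_apply ⟨z x, hr x⟩)
    obtain ⟨a, ha⟩ := hA.2 w
    refine ⟨f a + b, ?_⟩
    rw [map_add, ← hnat, ha]
    have : HomModule.map φ (IdemModule.map φ f) w = y - schurUnit φ B b := hw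
    rw [this, sub_add_cancel]

/-- The class of modules with bijective unit is closed under retracts. -/
theorem schurUnit_bijective_of_retract {i : A →ₗ[S] B} {r : B →ₗ[S] A}
    (hri : r ∘ₗ i = LinearMap.id) (hB : Function.Bijective (schurUnit φ B)) :
    Function.Bijective (schurUnit φ A) := by
  have hr (a : A) : r (i a) = a := LinearMap.congr_fun hri a
  constructor
  · intro a a' h
    have h1 : schurUnit φ B (i a) = schurUnit φ B (i a') := LinearMap.ext fun z =>
      Subtype.ext (by
        change z.1 • i a = z.1 • i a'
        rw [← map_smul, ← map_smul]
        exact congrArg i (congrArg Subtype.val (LinearMap.congr_fun h z)))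
    rw [← hr a, hB.1 h1, hr]
  · intro y
    obtain ⟨b, hb⟩ := hB.2 (HomModule.map φ (IdemModule.map φ i) y)
    refine ⟨r b, LinearMap.ext fun z => Subtype.ext ?_⟩
    have h1 : z.1 • b = i ((show IdemModule φ S →ₗ[H] IdemModule φ A from y) z).1 :=
      congrArg Subtype.val (LinearMap.congr_fun hb z)
    change z.1 • r b = ((show IdemModule φ S →ₗ[H] IdemModule φ A from y) z).1
    rw [← map_smul, h1, hr]

end SchurExact

/-! ### Vanishing criteria for Ext groups -/

section ExtVanishing

open Abelian

universe v₁ u₁ w₁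

variable {C : Type u₁} [Category.{v₁} C] [Abelian C] [HasExt.{w₁} C]

/-- `Ext¹(E, X)` vanishes when `Hom(E, -)` is exact in degree one on an injective resolution. -/
theorem ext_one_subsingleton_of_injectiveResolution {E X : C} (I : InjectiveResolution X)
    (h : ∀ f : E ⟶ I.cocomplex.X 1, f ≫ I.cocomplex.d 1 2 = 0 →
      ∃ g : E ⟶ I.cocomplex.X 0, g ≫ I.cocomplex.d 0 1 = f) :
    Subsingleton (Ext E X 1) := by
  obtain ⟨i, hi⟩ : ∃ i : X ⟶ I.cocomplex.X 0, i = I.ι.f 0 := ⟨_, rfl⟩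
  have hm : Mono i := by
    rw [hi]
    exact inferInstanceAs (Mono (I.ι.f 0))
  have hd : i ≫ I.cocomplex.d 0 1 = 0 := by
    rw [hi]
    exact I.ι_f_zero_comp_complex_d
  have hex : (ShortComplex.mk i (I.cocomplex.d 0 1) hd).Exact := by
    subst hi
    exact I.exact₀
  have hmono : Mono (cokernel.desc i (I.cocomplex.d 0 1) hd) := hex.mono_cokernelDesc
  have hS : (ShortComplex.mk i (cokernel.π i) (cokernel.condition i)).ShortExact :=
    { exact := ShortComplex.exact_cokernel i }
  have hinj : Injective (I.cocomplex.X 0) := I.injective 0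
  refine subsingleton_of_forall_eq 0 fun x => ?_
  obtain ⟨f, rfl⟩ := Ext.covariant_sequence_exact₁ E hS x
    (Ext.eq_zero_of_injective (I := I.cocomplex.X 0) _) (zero_add 1)
  obtain ⟨f, rfl⟩ := (Ext.mk₀_bijective _ _).2 f
  have hz : cokernel.desc i (I.cocomplex.d 0 1) hd ≫ I.cocomplex.d 1 2 = 0 := by
    rw [← cancel_epi (cokernel.π i), cokernel.π_desc_assoc, I.cocomplex.d_comp_d, comp_zero]
  obtain ⟨f', hf'⟩ : ∃ f' : E ⟶ cokernel i, f' = f := ⟨f, rfl⟩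
  -- The cokernel of X → I⁰ embeds in I¹, so f' becomes a cocycle. Writing it as a coboundary lifts
  -- f' to I⁰, and lifted maps have zero connecting class.
  obtain ⟨g, hg⟩ := h (f' ≫ cokernel.desc i (I.cocomplex.d 0 1) hd) (by
    rw [Category.assoc, hz, comp_zero])
  have hgf : g ≫ cokernel.π i = f' := by
    rw [← cancel_mono (cokernel.desc i (I.cocomplex.d 0 1) hd), Category.assoc,
      cokernel.π_desc, hg]
  subst hf'
  rw [← hgf, ← Ext.mk₀_comp_mk₀_assoc]
  exact (congrArg (fun z => (Ext.mk₀ g).comp z (zero_add 1)) hS.comp_extClass).trans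
    (Ext.comp_zero _ _ _ _ _)

theorem ext_subsingleton_of_shortExact {E : C} {S : ShortComplex C} (hS : S.ShortExact) {n : ℕ}
    (h₁ : Subsingleton (Ext E S.X₁ n)) (h₃ : Subsingleton (Ext E S.X₃ n)) :
    Subsingleton (Ext E S.X₂ n) := by
  refine subsingleton_of_forall_eq 0 fun x => ?_
  obtain ⟨y, rfl⟩ := Ext.covariant_sequence_exact₂ E hS x (Subsingleton.elim _ _)
  rw [Subsingleton.elim y 0, Ext.zero_comp]

theorem ext_subsingleton_of_iso {E X Y : C} (i : X ≅ Y) {n : ℕ}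
    (h : Subsingleton (Ext E X n)) : Subsingleton (Ext E Y n) := by
  refine subsingleton_of_forall_eq 0 fun x => ?_
  have hx : (x.comp (Ext.mk₀ i.inv) (add_zero n)).comp (Ext.mk₀ i.hom) (add_zero n) = x := by
    rw [Ext.comp_assoc_of_third_deg_zero, Ext.mk₀_comp_mk₀, i.inv_hom_id, Ext.comp_mk₀_id]
  rw [← hx, Subsingleton.elim (x.comp (Ext.mk₀ i.inv) (add_zero n)) 0, Ext.zero_comp]

end ExtVanishing

/-! ### Dévissage along filtrations -/

/-- A property of modules which holds for zero modules and is closed under extensions holds for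
filtered modules when it holds for the subquotients. -/
theorem HasFiltration.induction {R : Type u} [Ring R] {Λ : Type v} {X : Λ → ModuleCat.{u} R}
    {I : Set Λ} (P : ∀ (M : Type u) [AddCommGroup M] [Module R M], Prop)
    (zero : ∀ (M : Type u) [AddCommGroup M] [Module R M], Subsingleton M → P M)
    (ext : ∀ (A B C : Type u) [AddCommGroup A] [Module R A] [AddCommGroup B] [Module R B]
      [AddCommGroup C] [Module R C] (f : A →ₗ[R] B) (g : B →ₗ[R] C), Function.Injective f →
      Function.Exact f g → Function.Surjective g → P A → P C → P B)
    (hX : ∀ l ∈ I, P (X l)) (M : Type u) [AddCommGroup M] [Module R M]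
    (hM : HasFiltration X I M) : P M := by
  obtain ⟨n, F, hF, h0, hn, hq⟩ := hM
  have key : ∀ i ≤ n, P (F i) := by
    intro i
    induction i with
    | zero =>
      intro _
      refine zero _ ?_
      rw [h0]
      infer_instance
    | succ i ih =>
      intro hi
      obtain ⟨l, hl, ⟨E⟩⟩ := hq i hi
      refine ext (F i) (F (i + 1)) (X l) (Submodule.inclusion (hF i.le_succ))
        (E.toLinearMap ∘ₗ ((F i).submoduleOf (F (i + 1))).mkQ)
        (Submodule.inclusion_injective _) (fun x => ?_)
        (E.surjective.comp (Submodule.mkQ_surjective _)) (ih (Nat.le_of_succ_le hi)) (hX l hl)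
      rw [LinearMap.comp_apply, LinearEquiv.coe_coe, LinearEquiv.map_eq_zero_iff,
        Submodule.mkQ_apply, Submodule.Quotient.mk_eq_zero]
      exact ⟨fun hx => ⟨⟨x.1, hx⟩, rfl⟩, by rintro ⟨y, rfl⟩; exact y.2⟩
  -- P is not assumed invariant under isomorphism, so it passes from F n = ⊤ to M by an extension
  -- with zero quotient.
  refine ext (F n) M PUnit.{u + 1} (F n).subtype 0 Subtype.val_injective (fun x => ?_)
    (fun x => ⟨0, rfl⟩) (key n le_rfl) (zero _ inferInstance)
  exact ⟨fun _ => ⟨⟨x, hn ▸ Submodule.mem_top⟩, rfl⟩, fun _ => rfl⟩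

/-! ### Acyclic modules and the Ext¹ comparison -/

section SchurAcyclic

open Abelian

variable {K S H : Type u} [Field K] [Ring S] [Algebra K S] [Ring H] [Algebra K H]
  {e : S} {he : IsIdempotentElem e} (φ : H ≃ₐ[K] he.Corner)

/-- `M ≅ Hom_H(eS, eM)` canonically, and `Ext¹_H(eS, eM) = 0`. -/
structure IsSchurAcyclic (M : Type u) [AddCommGroup M] [Module S M] : Prop where
  unit_bijective : Function.Bijective (schurUnit φ M)
  ext_subsingleton :
    Subsingleton (Ext (ModuleCat.of H (IdemModule φ S)) (ModuleCat.of H (IdemModule φ M)) 1)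

theorem schurUnit_bijective_of_subsingleton (M : Type u) [AddCommGroup M] [Module S M]
    (h : Subsingleton M) : Function.Bijective (schurUnit φ M) :=
  ⟨fun _ _ _ => Subsingleton.elim _ _,
    fun _ => ⟨0, LinearMap.ext fun _ => Subtype.ext (Subsingleton.elim _ _)⟩⟩

theorem IsSchurAcyclic.of_subsingleton (M : Type u) [AddCommGroup M] [Module S M]
    (h : Subsingleton M) : IsSchurAcyclic φ M where
  unit_bijective := schurUnit_bijective_of_subsingleton φ M h
  ext_subsingleton := by
    have : Subsingleton (IdemModule φ M) :=
      ⟨fun _ _ => Subtype.ext (Subsingleton.elim (α := M) _ _)⟩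
    have hz : IsZero (ModuleCat.of H (IdemModule φ M)) := ModuleCat.isZero_of_subsingleton _
    refine subsingleton_of_forall_eq 0 fun x => ?_
    rw [← Ext.comp_mk₀_id x, hz.eq_of_src (𝟙 _) 0, Ext.mk₀_zero, Ext.comp_zero]

theorem IsSchurAcyclic.of_exact {A B C : Type u} [AddCommGroup A] [Module S A] [AddCommGroup B]
    [Module S B] [AddCommGroup C] [Module S C] {f : A →ₗ[S] B} {g : B →ₗ[S] C}
    (hf : Function.Injective f) (hfg : Function.Exact f g) (hg : Function.Surjective g)
    (hA : IsSchurAcyclic φ A) (hC : IsSchurAcyclic φ C) : IsSchurAcyclic φ B where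
  unit_bijective :=
    schurUnit_bijective_of_exact φ hf hfg hg hA.unit_bijective hC.unit_bijective
  ext_subsingleton := by
    have hex := IdemModule.map_exact φ hfg
    let T : ShortComplex (ModuleCat.{u} H) := ShortComplex.mk
      (ModuleCat.ofHom (IdemModule.map φ f)) (ModuleCat.ofHom (IdemModule.map φ g))
      (ModuleCat.hom_ext hex.linearMap_comp_eq_zero)
    have hT : T.ShortExact :=
      { exact := (ShortComplex.ShortExact.moduleCat_exact_iff_function_exact T).2 hex
        mono_f := (ModuleCat.mono_iff_injective _).2 (IdemModule.map_injective φ hf)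
        epi_g := (ModuleCat.epi_iff_surjective _).2 (IdemModule.map_surjective φ hg) }
    exact ext_subsingleton_of_shortExact hT hA.ext_subsingleton hC.ext_subsingleton

/-- R¹G(X) is the degree-one cohomology of Hom_H(eS, I^•) for an injective resolution I^• of X. -/
theorem ext_subsingleton_of_isZero_rightDerived (X : ModuleCat.{u} H)
    (h : IsZero (((inverseSchurFunctor φ).rightDerived 1).obj X)) :
    Subsingleton (Ext (ModuleCat.of H (IdemModule φ S)) X 1) := by
  let I := injectiveResolution X
  refine ext_one_subsingleton_of_injectiveResolution I fun f hf => ?_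
  have h1 : (((inverseSchurFunctor φ).mapHomologicalComplex _).obj I.cocomplex).ExactAt 1 :=
    (HomologicalComplex.exactAt_iff_isZero_homology _ _).2
      (h.of_iso (I.isoRightDerivedObj (inverseSchurFunctor φ) 1).symm)
  rw [HomologicalComplex.exactAt_iff' _ 0 1 2 (by simp) (by simp),
    ShortComplex.ShortExact.moduleCat_exact_iff_function_exact] at h1
  obtain ⟨g, hg⟩ := (h1 f.hom).1 (congrArg ModuleCat.Hom.hom hf)
  exact ⟨ModuleCat.ofHom g, ModuleCat.hom_ext hg⟩

theorem IsSchurAcyclic.inverseSchurFunctor (X : ModuleCat.{u} H)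
    (h : IsZero (((inverseSchurFunctor φ).rightDerived 1).obj X)) :
    IsSchurAcyclic φ ((inverseSchurFunctor φ).obj X) where
  unit_bijective := schurUnit_bijective_inverseSchurFunctor φ X
  ext_subsingleton := ext_subsingleton_of_iso (asIso ((schurAdjunction φ).counit.app X)).symm
    (ext_subsingleton_of_isZero_rightDerived φ X h)

/-- Surjectivity of G I → G Q says that every map eS → Q lifts to I; the obstruction lies in
Ext¹_H(eS, eN) = 0. -/
theorem IsSchurAcyclic.mapExtAddHom_one_bijective {N : ModuleCat.{u} S}
    (hN : IsSchurAcyclic φ N) (M : ModuleCat.{u} S) :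
    Function.Bijective ((schurFunctor φ).mapExtAddHom M N 1) := by
  let i := Injective.ι ((schurFunctor φ).obj N)
  have hS : (ShortComplex.mk i (cokernel.π i) (cokernel.condition i)).ShortExact :=
    { exact := ShortComplex.exact_cokernel i }
  refine _root_.mapExtAddHom_one_bijective (schurAdjunction φ)
    ((isIso_schurAdjunction_unit_iff φ N).2 hN.unit_bijective) inferInstance hS ?_ M
  refine (ModuleCat.epi_iff_surjective _).2 fun f => ?_
  have := hN.ext_subsingleton
  obtain ⟨g, hg⟩ := Ext.covariant_sequence_exact₃ (ModuleCat.of H (IdemModule φ S)) hS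
    (Ext.mk₀ (ModuleCat.ofHom f)) (zero_add 1)
    (Subsingleton.elim (α := Ext (ModuleCat.of H (IdemModule φ S))
      (ModuleCat.of H (IdemModule φ N)) 1) _ _)
  obtain ⟨g, rfl⟩ := (Ext.mk₀_bijective _ _).2 g
  rw [Ext.mk₀_comp_mk₀] at hg
  exact ⟨g.hom, congrArg ModuleCat.Hom.hom ((Ext.mk₀_bijective _ _).1 hg)⟩

end SchurAcyclic

/-! ### Bijective units on projective modules -/

section Projectives

variable {K S H : Type u} [Field K] [Ring S] [Algebra K S] [FiniteDimensional K S]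
  [Ring H] [Algebra K H] {e : S} {he : IsIdempotentElem e} (φ : H ≃ₐ[K] he.Corner)

/-- In a highest weight category whose standard modules have bijective unit, so do the projective
modules. -/
theorem schurUnit_bijective_of_projective {Λ : Type v} [PartialOrder Λ] {Δ : Λ → ModuleCat.{u} S}
    (hw : IsHighestWeightCategory K Δ) (hΔ : ∀ l, Function.Bijective (schurUnit φ (Δ l)))
    (N : Type u) [AddCommGroup N] [Module S N] [Module.Finite S N] [Module.Projective S N] :
    Function.Bijective (schurUnit φ N) := by
  have : IsNoetherianRing S := isNoetherian_of_tower K inferInstance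
  -- Candidates are images in N of modules with bijective unit; a maximal one will be all of N.
  let 𝒲 : Set (Submodule S N) := {W | ∃ (Q : ModuleCat.{u} S) (g : Q →ₗ[S] N),
    Function.Bijective (schurUnit φ Q) ∧ LinearMap.range g = W}
  obtain ⟨W, ⟨Q, g, hQ, hgW⟩, hmax⟩ := set_has_maximal_iff_noetherian.2
    (inferInstance : IsNoetherian S N) 𝒲 ⟨⊥, ModuleCat.of S PUnit, 0,
      schurUnit_bijective_of_subsingleton φ _ inferInstance, LinearMap.range_zero⟩
  have hW : W = ⊤ := by
    rw [← Submodule.Quotient.subsingleton_iff]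
    refine hw.eq_zero_of_hom (ModuleCat.of S (N ⧸ W)) (inferInstanceAs (Module.Finite S (N ⧸ W)))
      fun l f => ?_
    obtain ⟨P, p, _, _, hp, hker⟩ := hw.exists_projective l
    have hP : Function.Bijective (schurUnit φ P) := by
      refine schurUnit_bijective_of_exact φ (LinearMap.ker p).subtype_injective
        (LinearMap.exact_subtype_ker_map p) hp ?_ (hΔ l)
      exact HasFiltration.induction (fun M _ _ => Function.Bijective (schurUnit φ M))
        (fun M _ _ h => schurUnit_bijective_of_subsingleton φ M h)
        (fun _ _ _ _ _ _ _ _ _ _ _ hf hfg hg => schurUnit_bijective_of_exact φ hf hfg hg)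
        (fun l _ => hΔ l) _ hker
    -- A map Δ(l) → N/W, pulled back to P(l), lifts to N. Its image can be added to W by using Q ×
    -- P(l), so maximality puts it inside W and the map is zero.
    obtain ⟨h, hh⟩ := Module.projective_lifting_property W.mkQ (f.hom ∘ₗ p) W.mkQ_surjective
    have hmem : W ⊔ LinearMap.range h ∈ 𝒲 := by
      refine ⟨ModuleCat.of S (Q × P), g.coprod h, ?_, by rw [LinearMap.range_coprod, hgW]⟩
      exact schurUnit_bijective_of_exact φ (f := LinearMap.inl S Q P) (g := LinearMap.snd S Q P)
        LinearMap.inl_injective .inl_snd LinearMap.snd_surjective hQ hP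
    have hle : LinearMap.range h ≤ W := by
      by_contra hn
      exact hmax _ hmem (left_lt_sup.2 hn)
    refine ModuleCat.hom_ext (LinearMap.ext fun d => ?_)
    obtain ⟨x, rfl⟩ := hp d
    have hx : W.mkQ (h x) = f.hom (p x) := LinearMap.congr_fun hh x
    rw [← hx]
    exact (Submodule.Quotient.mk_eq_zero W).2 (hle ⟨x, rfl⟩)
  -- Now g is onto the projective N, so it splits and N is a retract of Q.
  obtain ⟨s, hs⟩ := Module.projective_lifting_property g LinearMap.id
    (LinearMap.range_eq_top.1 (hgW.trans hW))
  exact schurUnit_bijective_of_retract φ hs hQ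

end Projectives

/-! ### Finiteness of eM and representability by Se -/

section Representability

variable {K S H : Type u} [Field K] [Ring S] [Algebra K S]
  [Ring H] [Algebra K H] {e : S} {he : IsIdempotentElem e} (φ : H ≃ₐ[K] he.Corner)

/-- The projection `m ↦ e m`. -/
def idemProj (M : Type u) [AddCommGroup M] [Module S M] : M →+ IdemModule φ M where
  toFun m := ⟨e • m, by
    change e • e • m = e • m
    rw [smul_smul, he.eq]⟩
  map_zero' := Subtype.ext (smul_zero e)
  map_add' m n := Subtype.ext (smul_add e m n)

theorem idemProj_coe (M : Type u) [AddCommGroup M] [Module S M] (m : IdemModule φ M) :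
    idemProj φ M m.1 = m :=
  Subtype.ext m.2

theorem idemProj_smul (M : Type u) [AddCommGroup M] [Module S M] (c : K) (s : S) (m : M) :
    idemProj φ M ((c • s) • m) = algebraMap K H c • idemProj φ M (s • m) :=
  Subtype.ext (by
    change e • (c • s) • m = (φ (algebraMap K H c)).1 • e • s • m
    rw [coe_map_algebraMap]
    simp only [smul_smul, smul_mul_assoc, mul_smul_comm, ← mul_assoc, he.eq])

/-- For a K-basis (b_j) of S and S-generators m of M, the finitely many e b_j m span eM; scalars of
K can be pulled out because they act through H. -/
theorem finite_idemModule [FiniteDimensional K S] (M : Type u) [AddCommGroup M] [Module S M]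
    [hM : Module.Finite S M] : Module.Finite H (IdemModule φ M) := by
  obtain ⟨G, hG⟩ := hM.fg_top
  let b := Module.finBasis K S
  let w (x : G × Fin (Module.finrank K S)) : IdemModule φ M := idemProj φ M (b x.2 • x.1.1)
  have h₁ (m : M) (hm : m ∈ G) (s : S) :
      idemProj φ M (s • m) ∈ Submodule.span H (Set.range w) := by
    induction (b.mem_span s : s ∈ Submodule.span K (Set.range b)) using
      Submodule.span_induction with
    | mem s hs =>
      obtain ⟨j, rfl⟩ := hs
      exact Submodule.subset_span ⟨(⟨m, hm⟩, j), rfl⟩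
    | zero =>
      rw [zero_smul, map_zero]
      exact Submodule.zero_mem _
    | add s t _ _ hs ht =>
      rw [add_smul, map_add]
      exact Submodule.add_mem _ hs ht
    | smul c s _ hs =>
      rw [idemProj_smul]
      exact Submodule.smul_mem _ _ hs
  have h₂ (m : M) : ∀ s : S, idemProj φ M (s • m) ∈ Submodule.span H (Set.range w) := by
    induction (hG ▸ Submodule.mem_top : m ∈ Submodule.span S (G : Set M)) using
      Submodule.span_induction with
    | mem m hm => exact h₁ m hm
    | zero =>
      intro s
      rw [smul_zero, map_zero]
      exact Submodule.zero_mem _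
    | add m n _ _ hm hn =>
      intro s
      rw [smul_add, map_add]
      exact Submodule.add_mem _ (hm s) (hn s)
    | smul c m _ hm =>
      intro s
      rw [smul_smul]
      exact hm (s * c)
  have h₃ : Submodule.span H (Set.range w) = ⊤ := by
    rw [eq_top_iff]
    rintro m -
    have := h₂ m.1 1
    rwa [one_smul, idemProj_coe] at this
  exact ⟨h₃ ▸ Submodule.fg_span (Set.finite_range w)⟩

variable (S) in
/-- The projective module `Se`. -/
abbrev idemIdeal (e : S) : Submodule S S := LinearMap.range (LinearMap.toSpanSingleton S S e)

theorem idemIdeal_mul (he : IsIdempotentElem e) (x : idemIdeal S e) : x.1 * e = x.1 := by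
  obtain ⟨x, y, rfl⟩ := x
  change y * e * e = y * e
  rw [mul_assoc, he.eq]

theorem idemIdeal_projective (he : IsIdempotentElem e) : Module.Projective S (idemIdeal S e) :=
  Module.Projective.of_split (idemIdeal S e).subtype
    (LinearMap.toSpanSingleton S S e).rangeRestrict
    (LinearMap.ext fun x => Subtype.ext (idemIdeal_mul he x))

/-- The generator `e` of `Se`. -/
def idemIdealGenerator (e : S) : idemIdeal S e := ⟨e, 1, one_mul e⟩

theorem smul_idemIdealGenerator (he : IsIdempotentElem e) (x : idemIdeal S e) :
    x.1 • idemIdealGenerator e = x :=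
  Subtype.ext (idemIdeal_mul he x)

/-- A homomorphism from `Se` to `M` is the choice of an element of `eM`. -/
def idemIdealHomEquiv (M : Type u) [AddCommGroup M] [Module S M] :
    (idemIdeal S e →ₗ[S] M) ≃+ IdemModule φ M where
  toFun f := ⟨f (idemIdealGenerator e), by
    change e • f (idemIdealGenerator e) = f (idemIdealGenerator e)
    rw [← map_smul]
    exact congrArg f (Subtype.ext he.eq)⟩
  invFun m := (LinearMap.toSpanSingleton S M m.1) ∘ₗ (idemIdeal S e).subtype
  left_inv f := LinearMap.ext fun x => by
    change x.1 • f (idemIdealGenerator e) = f x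
    rw [← map_smul, smul_idemIdealGenerator he]
  right_inv m := Subtype.ext m.2
  map_add' _ _ := rfl

/-- Right multiplication by an element of `eSe` on `Se`. -/
def idemIdealRightMul (h : H) : idemIdeal S e →ₗ[S] idemIdeal S e :=
  (idemIdealHomEquiv φ (idemIdeal S e)).symm
    ⟨⟨(φ h).1, (φ h).1, coe_map_mul_idem φ h⟩, Subtype.ext (idem_mul_coe_map φ h)⟩

theorem idemIdealRightMul_coe (h : H) (x : idemIdeal S e) :
    (idemIdealRightMul φ h x).1 = x.1 * (φ h).1 := rfl

theorem idemIdealHomEquiv_comp_rightMul (M : Type u) [AddCommGroup M] [Module S M] (h : H)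
    (f : idemIdeal S e →ₗ[S] M) :
    idemIdealHomEquiv φ M (f ∘ₗ idemIdealRightMul φ h) = h • idemIdealHomEquiv φ M f :=
  Subtype.ext (by
    change f (idemIdealRightMul φ h (idemIdealGenerator e)) = (φ h).1 • f (idemIdealGenerator e)
    rw [← map_smul]
    refine congrArg f (Subtype.ext ?_)
    change e * (φ h).1 = (φ h).1 * e
    rw [idem_mul_coe_map, coe_map_mul_idem])

/-- An endomorphism of Se is determined by the image of e, which can be any element of e(Se) = eSe ≅
H. -/
theorem idemIdealRightMul_bijective : Function.Bijective (idemIdealRightMul φ) := by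
  constructor
  · intro h h' hh
    have := congrArg Subtype.val (LinearMap.congr_fun hh (idemIdealGenerator e))
    rw [idemIdealRightMul_coe, idemIdealRightMul_coe] at this
    exact φ.injective (Subtype.ext (((idem_mul_coe_map φ h).symm.trans this).trans
      (idem_mul_coe_map φ h')))
  · intro f
    obtain ⟨m, rfl⟩ := (idemIdealHomEquiv φ (idemIdeal S e)).symm.surjective f
    have hm : m.1.1 ∈ Subsemigroup.corner e := (Subsemigroup.mem_corner_iff he).2
      ⟨congrArg Subtype.val m.2, idemIdeal_mul he m.1⟩
    refine ⟨φ.symm ⟨m.1.1, hm⟩, LinearMap.ext fun x => Subtype.ext ?_⟩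
    rw [idemIdealRightMul_coe]
    exact congrArg (x.1 * ·) (congrArg Subtype.val (φ.apply_symm_apply ⟨m.1.1, hm⟩))

variable (S) in
/-- The object `Se` of the category of `S`-modules. -/
def idemIdealModuleCat (e : S) : ModuleCat.{u} S := ModuleCat.of S (idemIdeal S e)

/-- `H` is the opposite of the endomorphism algebra of `Se`. -/
noncomputable def idemIdealEndEquiv :
    H ≃ₐ[K] (Module.End S (idemIdealModuleCat S e))ᵐᵒᵖ :=
  AlgEquiv.ofBijective
    { toFun := fun h => MulOpposite.op (idemIdealRightMul φ h)
      map_one' := congrArg MulOpposite.op (LinearMap.ext fun x => Subtype.ext (by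
        change x.1 * (φ 1).1 = x.1
        rw [map_one]
        exact idemIdeal_mul he x))
      -- Right multiplication by ab applies a before b, which is the product in the opposite
      -- algebra.
      map_mul' := fun a b => congrArg MulOpposite.op (LinearMap.ext fun x => Subtype.ext (by
        change x.1 * (φ (a * b)).1 = (x.1 * (φ a).1) * (φ b).1
        rw [map_mul, mul_assoc]
        rfl))
      map_zero' := congrArg MulOpposite.op (LinearMap.ext fun x => Subtype.ext (by
        change x.1 * (φ 0).1 = 0
        rw [map_zero]
        exact mul_zero x.1))
      map_add' := fun a b => congrArg MulOpposite.op (LinearMap.ext fun x => Subtype.ext (by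
        change x.1 * (φ (a + b)).1 = x.1 * (φ a).1 + x.1 * (φ b).1
        rw [map_add, ← mul_add]
        rfl))
      commutes' := fun c => congrArg MulOpposite.op (LinearMap.ext fun x => Subtype.ext (by
        change x.1 * (φ (algebraMap K H c)).1 = algebraMap K S c * x.1
        rw [coe_map_algebraMap, mul_smul_comm, idemIdeal_mul he x, Algebra.smul_def])) }
    (MulOpposite.op_bijective.comp (idemIdealRightMul_bijective φ))

end Representability

/-! ### Assembling the cover -/

theorem theorem8 {K S H : Type u} [Field K] [Ring S] [Algebra K S] [FiniteDimensional K S]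
    [Ring H] [Algebra K H] [FiniteDimensional K H] {e : S} {he : IsIdempotentElem e}
    (φ : H ≃ₐ[K] he.Corner) {Λ : Type v} [PartialOrder Λ] [Finite Λ]
    (D : DualSpechtData K H Λ)
    (hw : IsHighestWeightCategory K fun l => (inverseSchurFunctor φ).obj (D.dualSpecht l))
    (hR : ∀ l, IsZero (((inverseSchurFunctor φ).rightDerived 1).obj (D.dualSpecht l))) :
    IsOneFaithfulCover K (fun l => (inverseSchurFunctor φ).obj (D.dualSpecht l))
      (schurFunctor φ) := by
  have hacyc (N : ModuleCat.{u} S)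
      (hN : HasFiltration (fun l => (inverseSchurFunctor φ).obj (D.dualSpecht l)) Set.univ N) :
      IsSchurAcyclic φ N :=
    HasFiltration.induction (fun M _ _ => IsSchurAcyclic φ M)
      (fun M _ _ => IsSchurAcyclic.of_subsingleton φ M)
      (fun _ _ _ _ _ _ _ _ _ _ _ => IsSchurAcyclic.of_exact φ)
      (fun l _ => IsSchurAcyclic.inverseSchurFunctor φ _ (hR l)) N hN
  -- Only the target needs a bijective unit; this serves both the projective case and degree zero of
  -- the Ext comparison.
  have hfull (M N : ModuleCat.{u} S) (hN : Function.Bijective (schurUnit φ N)) :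
      Function.Bijective ((schurFunctor φ).map : (M ⟶ N) → _) :=
    have := (isIso_schurAdjunction_unit_iff φ N).2 hN
    map_bijective_of_isIso_unit (schurAdjunction φ) M N
  exact
    { highestWeight := hw
      finite_obj := fun M _ => finite_idemModule φ M
      exists_projective := ⟨idemIdealModuleCat S e,
        Module.Finite.range (LinearMap.toSpanSingleton S S e),
        idemIdeal_projective he, idemIdealEndEquiv φ, fun M => idemIdealHomEquiv φ M,
        fun M h f => idemIdealHomEquiv_comp_rightMul φ M h f,
        fun _ _ _ _ => rfl⟩
      hom_bijective := fun M N _ _ _ _ => hfull M N (schurUnit_bijective_of_projective φ hw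
        (fun l => schurUnit_bijective_inverseSchurFunctor φ (D.dualSpecht l)) N)
      ext_bijective := fun M N _ hN j hj => by
        obtain rfl | rfl := Nat.le_one_iff_eq_zero_or_eq_one.1 hj
        · rw [Functor.mapExtAddHom_coe, Abelian.Ext.mapExactFunctor₀]
          exact Abelian.Ext.homEquiv₀.symm.bijective.comp
            ((hfull M N (hacyc N hN).unit_bijective).comp Abelian.Ext.homEquiv₀.bijective)
        · exact (hacyc N hN).mapExtAddHom_one_bijective φ M }
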